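/- **Setting.** For $n\ge 1$ put $[n]=\{1,\dots,n\}$. An interaction index $\mathcal E$ assigns a real number $\mathcal E_S(v,\ell)$ to every $n\ge1$, every set function $v:2^{[n]}\to\mathbb R$, every order $1\le \ell\le n$, and every $S\subseteq[n]$ with $|S|\le \ell$. **Faith-Interaction index.** A proper weighting function on $2^{[n]}$ is a map $\mu:2^{[n]}\to(0,\infty]$ that is finite on all $S$ with $1\le|S|\le n-1$. We say that $\mu$ is a weighting function of $\mathcal E$ for $n$ players if, for all $v:2^{[n]}\to\mathbb R$ and all $1\le\ell\le n$, the vector $(\mathcal E_S(v,\ell))_{|S|\le\ell}$ minimizes $$\sum_{S\subseteq[n],\,\mu(S)<\infty}\mu(S)\Big(v(S)-\sum_{T\subseteq S,\,|T|\le\ell}e_T\Big)^2$$ over all real vectors $(e_T)_{|T|\le\ell}$ that satisfy $v(S)=\sum_{T\subseteq S,|T|\le\ell}e_T$ whenever $\mu(S)=\infty$. The index $\mathcal E$ is a Faith-Interaction index for $n$ players if it has such a $\mu$ for $n$ players. **Axioms for $n$ players** (for all $1\le \ell\le n$ and all $v$ on $2^{[n]}$). * Linearity: $\mathcal E_S(\alpha_1v_1+\alpha_2v_2,\ell)=\alpha_1\mathcal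 E_S(v_1,\ell)+\alpha_2\mathcal E_S(v_2,\ell)$ for $|S|\le\ell$. * Symmetry: if $v(S\cup i)=v(S\cup j)$ for all $S\subseteq[n]\setminus\{i,j\}$, then $\mathcal E_{T\cup i}(v,\ell)=\mathcal E_{T\cup j}(v,\ell)$ for all $T\subseteq[n]\setminus\{i,j\}$ with $|T|<\ell$. * Dummy: if $v(S\cup i)=v(S)$ for all $S\subseteq[n]\setminus\{i\}$, then $\mathcal E_T(v,\ell)=0$ whenever $i\in T$, $|T|\le\ell$. * Generalized 2-efficiency: for $i\ne j$ let $v_{[ij]}$ be the set function on the $n-1$ players obtained by merging $i,j$ into one player $[ij]$, where $v_{[ij]}(S)=v(S)$ and $v_{[ij]}(S\cup[ij])=v(S\cup\{i,j\})$ for $S\subseteq[n]\setminus\{i,j\}$ (the $n-1$ players being named by $[n-1]$ in any way). Then $\mathcal E_{S\cup[ij]}(v_{[ij]},\ell)=\mathcal E_{S\cup i}(v,\ell)+\mathcal E_{S\cup j}(v,\ell)$ for all $S\subseteq[n]\setminus\{i,j\}$ with $\ell=|S|+1$. **Theorem (Faith-Banzhaf).** There is an interaction index $\mathcal E^{\mathrm{F\text{-}Bzf}}$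 which, for every number $n\ge1$ of players, is a Faith-Interaction index and satisfies linearity, symmetry, dummy and generalized 2-efficiency. Moreover, for every $d\ge3$: 1. (Uniqueness) If $\mathcal E$ is an interaction index that, for every number $1\le n\le d$ of players, is a Faith-Interaction index and satisfies the four axioms, then $\mathcal E_S(v,\ell)=\mathcal E_S^{\mathrm{F\text{-}Bzf}}(v,\ell)$ for all $v:2^{[d]}\to\mathbb R$, $1\le\ell\le d$ and $|S|\le\ell$. 2. (Weights) The weighting functions of $\mathcal E^{\mathrm{F\text{-}Bzf}}$ for $d$ players are exactly the functions $\mu(S)=c\cdot\frac1{2^d}$ $(S\subseteq[d])$ with a constant $0<c<\infty$. 3. (Closed form) With the Möbius transform $a(v,S)=\sum_{T\subseteq S}(-1)^{|S|-|T|}v(T)$, for all $v:2^{[d]}\to\mathbb R$, $1\le\ell\le d$ and $|S|\le \ell$, $$\mathcal E_S^{\mathrm{F\text{-}Bzf}}(v,\ell)=a(v,S)+(-1)^{\ell-|S|}\sum_{T\supseteq S,\ |T|>\ell}\Big(\frac12\Big)^{|T|-|S|}\binom{|T|-|S|-1}{\ell-|S|}\,a(v,T).$$ 4. (Highest order) For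 all $v:2^{[d]}\to\mathbb R$, $1\le\ell\le d$ and $|S|=\ell$, the value is the Banzhaf interaction index: $$\mathcal E_S^{\mathrm{F\text{-}Bzf}}(v,\ell)=\sum_{T\subseteq[d]\setminus S}\frac1{2^{d-|S|}}\,\Delta_S(v(T)),\qquad \Delta_S(v(T))=\sum_{L\subseteq S}(-1)^{|S|-|L|}v(T\cup L).$$ -/

import Mathlib

open Finset
open scoped ENNReal

namespace FaithInteraction

/-- A set function (game) on the player set `[n]`. -/
abbrev SetFunction (n : ℕ) : Type := Finset (Fin n) → ℝ

/-- An interaction index assigns to every number `n` of players, every maximum interaction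
order `ℓ` and every set function `v` on `[n]` the values `E n ℓ v S`.  Only `1 ≤ ℓ ≤ n` and
coalitions `S` with `|S| ≤ ℓ` are meaningful; no definition below looks at other values. -/
abbrev InteractionIndex : Type := (n : ℕ) → ℕ → SetFunction n → Finset (Fin n) → ℝ

/-- The Möbius transform `a(v, S)`. -/
def moebius {n : ℕ} (v : SetFunction n) (S : Finset (Fin n)) : ℝ :=
  ∑ T ∈ S.powerset, (-1) ^ (#S - #T) * v T

/-- The discrete derivative `Δ_S (v(T))` (for disjoint `S`, `T`). -/
def discreteDerivative {n : ℕ} (S : Finset (Fin n)) (v : SetFunction n)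
    (T : Finset (Fin n)) : ℝ :=
  ∑ L ∈ S.powerset, (-1) ^ (#S - #L) * v (T ∪ L)

/-- The Banzhaf interaction index of the coalition `S`. -/
noncomputable def banzhaf {n : ℕ} (v : SetFunction n) (S : Finset (Fin n)) : ℝ :=
  ∑ T ∈ (univ \ S).powerset, 1 / 2 ^ (n - #S) * discreteDerivative S v T

/-! ### Faith-Interaction indices -/

/-- A proper weighting function: values in `(0, ∞]`, and finite on every coalition other than
the empty and the full one. -/
def IsProperWeighting {n : ℕ} (μ : Finset (Fin n) → ℝ≥0∞) : Prop :=
  (∀ S, 0 < μ S) ∧ ∀ S, 1 ≤ #S → #S ≤ n - 1 → μ S ≠ ∞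

/-- The approximation `∑_{T ⊆ S, |T| ≤ ℓ} e_T` of the value of `S`. -/
def approx {n : ℕ} (ℓ : ℕ) (e : Finset (Fin n) → ℝ) (S : Finset (Fin n)) : ℝ :=
  ∑ T ∈ S.powerset with #T ≤ ℓ, e T

/-- The weighted regression objective; it sums over the coalitions of finite weight. -/
noncomputable def objective {n : ℕ} (μ : Finset (Fin n) → ℝ≥0∞) (ℓ : ℕ) (v : SetFunction n)
    (e : Finset (Fin n) → ℝ) : ℝ :=
  open Classical in ∑ S with μ S ≠ ∞, (μ S).toReal * (v S - approx ℓ e S) ^ 2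

/-- The feasible set: coalitions of infinite weight are to be fitted exactly. -/
def feasible {n : ℕ} (μ : Finset (Fin n) → ℝ≥0∞) (ℓ : ℕ) (v : SetFunction n) :
    Set (Finset (Fin n) → ℝ) :=
  {e | ∀ S, μ S = ∞ → v S = approx ℓ e S}

/-- `e` solves the (constrained) weighted regression problem for `v` of order `ℓ`. -/
def IsRegressionSolution {n : ℕ} (μ : Finset (Fin n) → ℝ≥0∞) (ℓ : ℕ) (v : SetFunction n)
    (e : Finset (Fin n) → ℝ) : Prop :=
  e ∈ feasible μ ℓ v ∧ IsMinOn (objective μ ℓ v) (feasible μ ℓ v) e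

/-- `μ` is a proper weighting function of the index `E` for `n` players: one and the same `μ`
serves all set functions and all orders. -/
def IsWeightingOf {n : ℕ} (μ : Finset (Fin n) → ℝ≥0∞) (E : InteractionIndex) : Prop :=
  IsProperWeighting μ ∧
    ∀ ℓ, 1 ≤ ℓ → ℓ ≤ n → ∀ v : SetFunction n, IsRegressionSolution μ ℓ v (E n ℓ v)

/-- `E` is a Faith-Interaction index for `n` players. -/
def IsFaith (n : ℕ) (E : InteractionIndex) : Prop :=
  ∃ μ : Finset (Fin n) → ℝ≥0∞, IsWeightingOf μ E

/-! ### The axioms, for `n` players -/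

def Linearity (n : ℕ) (E : InteractionIndex) : Prop :=
  ∀ ℓ, 1 ≤ ℓ → ℓ ≤ n → ∀ (v₁ v₂ : SetFunction n) (α₁ α₂ : ℝ) (S : Finset (Fin n)), #S ≤ ℓ →
    E n ℓ (α₁ • v₁ + α₂ • v₂) S = α₁ * E n ℓ v₁ S + α₂ * E n ℓ v₂ S

def Symmetry (n : ℕ) (E : InteractionIndex) : Prop :=
  ∀ ℓ, 1 ≤ ℓ → ℓ ≤ n → ∀ (v : SetFunction n) (i j : Fin n),
    (∀ S, i ∉ S → j ∉ S → v (insert i S) = v (insert j S)) →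
    ∀ T, i ∉ T → j ∉ T → #T < ℓ → E n ℓ v (insert i T) = E n ℓ v (insert j T)

def Dummy (n : ℕ) (E : InteractionIndex) : Prop :=
  ∀ ℓ, 1 ≤ ℓ → ℓ ≤ n → ∀ (v : SetFunction n) (i : Fin n),
    (∀ S, i ∉ S → v (insert i S) = v S) →
    ∀ T, i ∈ T → #T ≤ ℓ → E n ℓ v T = 0

/-- The reduced set function `v_[ij]` on `n - 1` players, when `π` is a surjection
`[n] → [n - 1]` that sends `i` and `j` to the same player `[ij]` (and so is injective
otherwise): a coalition is worth what the players it stands for are worth together. -/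
def reduced {n : ℕ} (π : Fin n → Fin (n - 1)) (v : SetFunction n) : SetFunction (n - 1) :=
  fun S => v {k | π k ∈ S}

/-- Generalized interaction 2-efficiency, from `n` to `n - 1` players.  `π` is any naming, by
the elements of `[n - 1]`, of the players that remain when `i` and `j` are merged. -/
def TwoEfficiency (n : ℕ) (E : InteractionIndex) : Prop :=
  ∀ (i j : Fin n), i ≠ j →
    ∀ π : Fin n → Fin (n - 1), Function.Surjective π → π i = π j →
    ∀ (v : SetFunction n) (S : Finset (Fin n)), i ∉ S → j ∉ S →
      E (n - 1) (#S + 1) (reduced π v) (insert (π i) (S.image π)) =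
        E n (#S + 1) v (insert i S) + E n (#S + 1) v (insert j S)

/-- `E` is, for `n` players, a Faith-Interaction index with the four axioms. -/
structure IsAdmissible (n : ℕ) (E : InteractionIndex) : Prop where
  faith : IsFaith n E
  linearity : Linearity n E
  symmetry : Symmetry n E
  dummy : Dummy n E
  twoEfficiency : TwoEfficiency n E

end FaithInteraction

open FaithInteraction

/-! For constant weights the regression of order `ℓ` is orthogonal projection onto the span of the
Walsh functions of order at most `ℓ`. The closed form solves it because it reproduces the Walsh
coefficients of `v` up to order `ℓ` (`sum_walsh_mul_approx_faithBanzhaf`), which reduces to an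
alternating binomial identity. At `#S = ℓ` it is a rescaled Walsh coefficient of `v`, hence the
Banzhaf index; 2-efficiency then holds because the Walsh functions of `S ∪ i` and `S ∪ j` cancel on
coalitions separating `i` from `j` and agree on the others.

For uniqueness, order 1 suffices. By 2-efficiency and induction on the number of players, the errors
against the Banzhaf values sum to zero over any two players, so with three players they vanish
(`IsAdmissible.eq_of_order_one`). Such an index forces `μ` to be constant (`weighting_const`): for
`#B ≥ 2` the game `walsh B / μ` is `μ`-orthogonal to all functions of degree 1, so its Banzhaf
values vanish. This kills the Walsh coefficients of `1 / μ` at the symmetric differences of `B` and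
`{i}`, which for `n ≥ 3` include all nonempty coalitions. Since regressions with positive weights
have unique solutions, the constant `μ` determines the index at every order. -/

namespace FaithInteraction

/-! ### Walsh functions -/

/-- The Walsh function `(-1) ^ |T ∩ U|`. -/
def walsh {n : ℕ} (T U : Finset (Fin n)) : ℝ := (-1) ^ #(T ∩ U)

variable {n : ℕ}

lemma walsh_comm (T U : Finset (Fin n)) : walsh T U = walsh U T := by
  simp only [walsh, inter_comm]

lemma walsh_eq_prod (T U : Finset (Fin n)) :
    walsh T U = ∏ i ∈ T, if i ∈ U then (-1 : ℝ) else 1 := by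
  rw [prod_ite, prod_const_one, mul_one, prod_const, filter_mem_eq_inter, walsh]

lemma walsh_singleton (i : Fin n) (U : Finset (Fin n)) :
    walsh {i} U = if i ∈ U then -1 else 1 := by
  rw [walsh_eq_prod, prod_singleton]

lemma walsh_insert {i : Fin n} {T : Finset (Fin n)} (hi : i ∉ T) (U : Finset (Fin n)) :
    walsh (insert i T) U = walsh {i} U * walsh T U := by
  simp only [walsh_eq_prod, prod_insert hi, prod_singleton]

lemma walsh_mul_self (T U : Finset (Fin n)) : walsh T U * walsh T U = 1 := by
  rw [walsh, ← mul_pow]; norm_num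

@[simp] lemma walsh_empty (U : Finset (Fin n)) : walsh ∅ U = 1 := by simp [walsh]

/-- The sum factors over players: one in `R` contributes its sign, one outside `R` contributes `1 -
1` or `1 + 1` according to membership in `T`. -/
lemma sum_walsh_superset (T R : Finset (Fin n)) :
    ∑ U with R ⊆ U, walsh T U = if T ⊆ R then (-1) ^ #T * 2 ^ (n - #R) else 0 := by
  have h := prod_add (fun i : Fin n => if i ∈ T then (-1 : ℝ) else 1)
    (fun i => if i ∈ R then 0 else 1) univ
  have h1 : ∑ U with R ⊆ U, walsh T U =
      ∏ i : Fin n, ((if i ∈ T then (-1 : ℝ) else 1) + (if i ∈ R then 0 else 1)) := by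
    rw [h, powerset_univ, sum_filter]
    refine sum_congr rfl fun U _ => ?_
    rw [← walsh_eq_prod, walsh_comm U T]
    split_ifs with hR
    · rw [prod_eq_one, mul_one]
      intro i hi
      rw [if_neg]
      exact fun hiR => (mem_sdiff.1 hi).2 (hR hiR)
    · obtain ⟨i, hiR, hiU⟩ := not_subset.1 hR
      rw [prod_eq_zero (i := i), mul_zero]
      · simpa using hiU
      · simp [hiR]
  rw [h1]
  split_ifs with hT
  · have h2 : ∀ i : Fin n, ((if i ∈ T then (-1 : ℝ) else 1) + (if i ∈ R then 0 else 1)) =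
        (if i ∈ T then (-1 : ℝ) else 1) * (if i ∈ Rᶜ then 2 else 1) := by
      intro i
      by_cases hiT : i ∈ T
      · simp [hiT, hT hiT]
      · by_cases hiR : i ∈ R <;> (simp [hiT, hiR]; try norm_num)
    rw [prod_congr rfl fun i _ => h2 i, prod_mul_distrib, prod_ite_mem, prod_ite_mem]
    simp [card_compl]
  · obtain ⟨i, hiT, hiR⟩ := not_subset.1 hT
    exact prod_eq_zero (mem_univ i) (by simp [hiT, hiR])

lemma sum_walsh_mul_walsh (A B : Finset (Fin n)) :
    ∑ T, walsh T A * walsh T B = if A = B then 2 ^ n else 0 := by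
  have h1 : ∑ T, walsh T A * walsh T B =
      ∏ i : Fin n, (1 + (if i ∈ A then (-1 : ℝ) else 1) * (if i ∈ B then (-1 : ℝ) else 1)) := by
    rw [prod_one_add, powerset_univ]
    refine sum_congr rfl fun T _ => ?_
    rw [walsh_eq_prod, walsh_eq_prod, prod_mul_distrib]
  rw [h1]
  split_ifs with h
  · subst h
    rw [prod_congr rfl (g := fun _ => (2 : ℝ))]
    · simp
    · intro i _
      split_ifs <;> norm_num
  · have : ∃ i, ¬ (i ∈ A ↔ i ∈ B) := by
      by_contra! hc
      exact h (ext hc)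
    obtain ⟨i, hi⟩ := this
    refine prod_eq_zero (mem_univ i) ?_
    by_cases hA : i ∈ A <;> by_cases hB : i ∈ B <;> simp_all

/-- Expands the product over `i ∈ S` of `(1 - walsh {i} U) / 2`. Hence functions of degree at most
`ℓ` are combinations of Walsh functions of order at most `ℓ`. -/
lemma indicator_subset_eq (S U : Finset (Fin n)) :
    (if S ⊆ U then (1 : ℝ) else 0) =
      (1 / 2) ^ #S * ∑ T ∈ S.powerset, (-1) ^ #T * walsh T U := by
  have h : ∑ T ∈ S.powerset, (-1) ^ #T * walsh T U =
      ∏ i ∈ S, (1 + if i ∈ U then (1 : ℝ) else -1) := by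
    rw [prod_one_add]
    refine sum_congr rfl fun T _ => ?_
    rw [walsh_eq_prod, ← prod_const, ← prod_mul_distrib]
    refine prod_congr rfl fun i _ => ?_
    split_ifs <;> norm_num
  rw [h, ← prod_const, ← prod_mul_distrib]
  split_ifs with hS
  · refine (prod_eq_one fun i hi => ?_).symm
    rw [if_pos (hS hi)]; norm_num
  · obtain ⟨i, hiS, hiU⟩ := not_subset.1 hS
    exact (prod_eq_zero hiS (by simp [hiU])).symm

/-- A function all of whose nontrivial Walsh coefficients vanish is constant. -/
lemma eq_average_of_walsh_eq_zero (f : Finset (Fin n) → ℝ)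
    (hf : ∀ T : Finset (Fin n), T.Nonempty → ∑ U, walsh T U * f U = 0) (A : Finset (Fin n)) :
    2 ^ n * f A = ∑ U, f U := by
  have h1 : ∑ T, walsh T A * ∑ U, walsh T U * f U = ∑ U, f U := by
    rw [sum_eq_single ∅]
    · simp
    · intro T _ hT
      rw [hf T (nonempty_iff_ne_empty.2 hT), mul_zero]
    · simp
  rw [← h1]
  simp_rw [mul_sum]
  rw [sum_comm]
  simp_rw [← mul_assoc, ← sum_mul, sum_walsh_mul_walsh]
  simp

/-! ### The Möbius transform -/

lemma sum_Icc_card {T R : Finset (Fin n)} (h : T ⊆ R) (f : ℕ → ℝ) :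
    ∑ S ∈ Icc T R, f #S =
      ∑ k ∈ range (#R - #T + 1), ((#R - #T).choose k : ℝ) * f (#T + k) := by
  have hd : ∀ X ∈ (R \ T).powerset, Disjoint T X := fun X hX =>
    disjoint_sdiff.mono_right (mem_powerset.1 hX)
  rw [Icc_eq_image_powerset h, sum_image]
  · rw [sum_congr rfl fun X hX => by rw [card_union_of_disjoint (hd X hX)],
      sum_powerset_apply_card (fun k => f (#T + k)), card_sdiff_of_subset h]
    simp
  · intro X hX Y hY hXY
    have := congrArg (· \ T) hXY
    simpa [union_sdiff_distrib, sdiff_eq_self_of_disjoint (hd X hX).symm,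
      sdiff_eq_self_of_disjoint (hd Y hY).symm] using this

lemma sum_range_neg_one_pow_choose (N : ℕ) :
    ∑ k ∈ range (N + 1), (-1 : ℝ) ^ k * (N.choose k : ℝ) = if N = 0 then 1 else 0 := by
  exact_mod_cast congrArg (Int.cast : ℤ → ℝ) (Int.alternating_sum_range_choose (n := N))

lemma sum_moebius_powerset (v : SetFunction n) (S : Finset (Fin n)) :
    ∑ R ∈ S.powerset, moebius v R = v S := by
  unfold moebius
  have h1 : ∀ R T : Finset (Fin n), (R ∈ S.powerset ∧ T ∈ R.powerset) ↔
      (R ∈ Icc T S ∧ T ∈ S.powerset) := by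
    intro R T
    simp only [mem_powerset, mem_Icc]
    exact ⟨fun h => ⟨⟨h.2, h.1⟩, h.2.trans h.1⟩, fun h => ⟨h.1.2, h.1.1⟩⟩
  rw [sum_comm' h1]
  simp_rw [← sum_mul]
  rw [sum_eq_single_of_mem S (mem_powerset_self S)]
  · simp
  · intro T hT hne
    rw [mem_powerset] at hT
    rw [sum_Icc_card hT (fun k => (-1) ^ (k - #T))]
    have hlt : #T < #S := card_lt_card (hT.ssubset_of_ne hne)
    have := sum_range_neg_one_pow_choose (#S - #T)
    rw [if_neg (by omega)] at this
    simp_rw [Nat.add_sub_cancel_left]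
    rw [sum_congr rfl fun k _ => mul_comm _ _, this, zero_mul]

lemma approx_moebius (v : SetFunction n) (S : Finset (Fin n)) : approx n (moebius v) S = v S := by
  rw [approx, filter_true_of_mem, sum_moebius_powerset]
  exact fun T _ => by simpa using card_le_univ T

lemma sum_mul_approx (ℓ : ℕ) (e g : Finset (Fin n) → ℝ) :
    ∑ U, g U * approx ℓ e U = ∑ S with #S ≤ ℓ, e S * ∑ U with S ⊆ U, g U := by
  simp only [approx, mul_sum]
  rw [sum_comm' (s' := fun S => ({U | S ⊆ U} : Finset (Finset (Fin n))))
    (t' := ({S | #S ≤ ℓ} : Finset (Finset (Fin n))))]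
  · exact sum_congr rfl fun S _ => sum_congr rfl fun U _ => mul_comm _ _
  · intro U S
    simp

lemma sum_walsh_mul_approx (ℓ : ℕ) (e : Finset (Fin n) → ℝ) (T : Finset (Fin n)) :
    ∑ U, walsh T U * approx ℓ e U =
      (-1) ^ #T * ∑ S with T ⊆ S ∧ #S ≤ ℓ, 2 ^ (n - #S) * e S := by
  rw [sum_mul_approx, mul_sum, sum_filter, sum_filter]
  refine sum_congr rfl fun S _ => ?_
  rw [sum_walsh_superset]
  by_cases h1 : #S ≤ ℓ <;> by_cases h2 : T ⊆ S <;> simp [h1, h2]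
  ring

lemma sum_walsh_mul (v : SetFunction n) (T : Finset (Fin n)) :
    ∑ U, walsh T U * v U = (-1) ^ #T * ∑ S with T ⊆ S, 2 ^ (n - #S) * moebius v S := by
  have h := sum_walsh_mul_approx n (moebius v) T
  simp_rw [approx_moebius] at h
  rw [h]
  congr 2
  ext S
  simpa using fun _ => by simpa using card_le_univ S

lemma moebius_linear (v₁ v₂ : SetFunction n) (α₁ α₂ : ℝ) (S : Finset (Fin n)) :
    moebius (α₁ • v₁ + α₂ • v₂) S = α₁ * moebius v₁ S + α₂ * moebius v₂ S := by
  simp only [moebius, mul_sum, ← sum_add_distrib]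
  refine sum_congr rfl fun T _ => ?_
  simp only [Pi.add_apply, Pi.smul_apply, smul_eq_mul]
  ring

lemma moebius_eq_zero_of_dummy {v : SetFunction n} {i : Fin n}
    (hv : ∀ S, i ∉ S → v (insert i S) = v S) {T : Finset (Fin n)} (hi : i ∈ T) :
    moebius v T = 0 := by
  have hni : i ∉ T.erase i := notMem_erase i T
  rw [← insert_erase hi, moebius, sum_powerset_insert hni, ← sum_add_distrib]
  refine sum_eq_zero fun S hS => ?_
  have hS' := mem_powerset.1 hS
  have hiS : i ∉ S := fun h => hni (hS' h)
  have hc := card_le_card hS'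
  rw [hv S hiS, card_insert_of_notMem hni, card_insert_of_notMem hiS, Nat.add_sub_add_right,
    Nat.sub_add_comm hc, pow_succ]
  ring

lemma moebius_map {v : SetFunction n} (σ : Equiv.Perm (Fin n))
    (hv : ∀ U, v (U.map σ.toEmbedding) = v U) (S : Finset (Fin n)) :
    moebius v (S.map σ.toEmbedding) = moebius v S := by
  refine (sum_equiv σ.finsetCongr (fun T => ?_) fun T _ => ?_).symm
  · simp
  · simp [hv]

/-! ### Weighted regression -/

/-- The residual of `e` is orthogonal to all feasible directions of the regression problem. -/
def IsOrthogonal (μ : Finset (Fin n) → ℝ≥0∞) (ℓ : ℕ) (v : SetFunction n)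
    (e : Finset (Fin n) → ℝ) : Prop :=
  ∀ f : Finset (Fin n) → ℝ, (∀ S, μ S = ∞ → approx ℓ f S = 0) →
    ∑ S, (μ S).toReal * ((v S - approx ℓ e S) * approx ℓ f S) = 0

/-- Since `∞.toReal = 0`, coalitions of infinite weight drop out of the unrestricted sum. -/
lemma objective_eq (μ : Finset (Fin n) → ℝ≥0∞) (ℓ : ℕ) (v : SetFunction n)
    (e : Finset (Fin n) → ℝ) :
    objective μ ℓ v e = ∑ S, (μ S).toReal * (v S - approx ℓ e S) ^ 2 := by
  classical
  rw [objective, sum_filter]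
  refine sum_congr rfl fun S _ => ?_
  by_cases h : μ S = ∞ <;> simp [h]

lemma approx_sub (ℓ : ℕ) (e f : Finset (Fin n) → ℝ) (S : Finset (Fin n)) :
    approx ℓ (e - f) S = approx ℓ e S - approx ℓ f S := by
  simp [approx]

/-- Pythagoras: `f - e` is a feasible direction, so the cross term vanishes. -/
lemma IsOrthogonal.objective_eq_add {μ : Finset (Fin n) → ℝ≥0∞} {ℓ : ℕ} {v : SetFunction n}
    {e f : Finset (Fin n) → ℝ} (h : IsOrthogonal μ ℓ v e) (he : e ∈ feasible μ ℓ v)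
    (hf : f ∈ feasible μ ℓ v) :
    objective μ ℓ v f = objective μ ℓ v e + ∑ S, (μ S).toReal * (approx ℓ (f - e) S) ^ 2 := by
  have h0 := h (f - e) fun S hS => by rw [approx_sub, ← hf S hS, ← he S hS, sub_self]
  have h1 : objective μ ℓ v f = objective μ ℓ v e +
      ∑ S, (μ S).toReal * (approx ℓ (f - e) S) ^ 2 -
      2 * ∑ S, (μ S).toReal * ((v S - approx ℓ e S) * approx ℓ (f - e) S) := by
    rw [objective_eq, objective_eq, mul_sum, ← sum_add_distrib, ← sum_sub_distrib]
    refine sum_congr rfl fun S _ => ?_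
    rw [approx_sub]
    ring
  rw [h1, h0]
  ring

lemma IsOrthogonal.isRegressionSolution {μ : Finset (Fin n) → ℝ≥0∞} {ℓ : ℕ}
    {v : SetFunction n} {e : Finset (Fin n) → ℝ} (h : IsOrthogonal μ ℓ v e)
    (he : e ∈ feasible μ ℓ v) : IsRegressionSolution μ ℓ v e := by
  refine ⟨he, fun f hf => ?_⟩
  rw [Set.mem_ofPred_eq, h.objective_eq_add he hf]
  exact le_add_of_nonneg_right
    (sum_nonneg fun S _ => mul_nonneg ENNReal.toReal_nonneg (sq_nonneg _))

/-- The system is triangular with respect to inclusion. -/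
lemma eq_zero_of_approx_eq_zero {ℓ : ℕ} {e : Finset (Fin n) → ℝ} (h : ∀ S, approx ℓ e S = 0)
    (S : Finset (Fin n)) (hS : #S ≤ ℓ) : e S = 0 := by
  induction S using Finset.strongInduction with
  | H S ih =>
    have h1 := h S
    rwa [approx, sum_eq_single_of_mem S (by simpa using hS)] at h1
    intro T hT hne
    simp only [mem_filter, mem_powerset] at hT
    exact ih T (hT.1.ssubset_of_ne hne) hT.2

/-- By Pythagoras a minimizer has the same approximation as `e` wherever the weight is finite;
elsewhere the constraints force it. -/
lemma IsRegressionSolution.eq_of_isOrthogonal {μ : Finset (Fin n) → ℝ≥0∞} (hμ : ∀ S, 0 < μ S)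
    {ℓ : ℕ} {v : SetFunction n} {e f : Finset (Fin n) → ℝ} (hf : IsRegressionSolution μ ℓ v f)
    (he : e ∈ feasible μ ℓ v) (h : IsOrthogonal μ ℓ v e) (S : Finset (Fin n)) (hS : #S ≤ ℓ) :
    f S = e S := by
  have h1 : objective μ ℓ v f ≤ objective μ ℓ v e := hf.2 he
  rw [h.objective_eq_add he hf.1] at h1
  have hnn : ∀ S ∈ univ, 0 ≤ (μ S).toReal * (approx ℓ (f - e) S) ^ 2 := fun S _ =>
    mul_nonneg ENNReal.toReal_nonneg (sq_nonneg _)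
  have h2 := (sum_eq_zero_iff_of_nonneg hnn).1
    (le_antisymm (by linarith) (sum_nonneg hnn))
  refine sub_eq_zero.1 (eq_zero_of_approx_eq_zero (e := f - e) (fun U => ?_) S hS)
  by_cases hU : μ U = ∞
  · rw [approx_sub, ← hf.1 U hU, ← he U hU, sub_self]
  · have h3 : (μ U).toReal ≠ 0 := (ENNReal.toReal_pos (hμ U).ne' hU).ne'
    simpa [h3] using h2 U (mem_univ U)

/-! ### The Faith-Banzhaf index -/

/-- The Faith-Banzhaf interaction index, in closed form. -/
noncomputable def faithBanzhaf : InteractionIndex := fun _ ℓ v S =>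
  moebius v S + (-1) ^ (ℓ - #S) *
    ∑ T with S ⊆ T ∧ ℓ < #T,
      (1 / 2) ^ (#T - #S) * ((#T - #S - 1).choose (ℓ - #S) : ℝ) * moebius v T

lemma faithBanzhaf_linearity (n : ℕ) : Linearity n faithBanzhaf := by
  intro ℓ _ _ v₁ v₂ α₁ α₂ S _
  simp only [faithBanzhaf, moebius_linear, mul_add, sum_add_distrib]
  have h : ∀ (α : ℝ) (w : SetFunction n),
      ∑ T with S ⊆ T ∧ ℓ < #T, (1 / 2 : ℝ) ^ (#T - #S) * ((#T - #S - 1).choose (ℓ - #S) : ℝ) *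
        (α * moebius w T) =
      α * ∑ T with S ⊆ T ∧ ℓ < #T, (1 / 2 : ℝ) ^ (#T - #S) *
        ((#T - #S - 1).choose (ℓ - #S) : ℝ) * moebius w T := by
    intro α w
    rw [mul_sum]
    exact sum_congr rfl fun T _ => by ring
  rw [h, h]
  ring

lemma faithBanzhaf_dummy (n : ℕ) : Dummy n faithBanzhaf := by
  intro ℓ _ _ v i hv T hi _
  rw [faithBanzhaf, moebius_eq_zero_of_dummy hv hi, sum_eq_zero]
  · simp
  · intro R hR
    rw [moebius_eq_zero_of_dummy hv ((mem_filter.1 hR).2.1 hi), mul_zero]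

lemma faithBanzhaf_map {v : SetFunction n} (σ : Equiv.Perm (Fin n))
    (hv : ∀ U, v (U.map σ.toEmbedding) = v U) (ℓ : ℕ) (S : Finset (Fin n)) :
    faithBanzhaf n ℓ v (S.map σ.toEmbedding) = faithBanzhaf n ℓ v S := by
  rw [faithBanzhaf, moebius_map σ hv, card_map]
  congr 2
  refine (sum_equiv σ.finsetCongr (fun T => ?_) fun T _ => ?_).symm
  · simp
  · simp [moebius_map σ hv]

lemma map_swap_of_notMem {i j : Fin n} {S : Finset (Fin n)} (hi : i ∉ S) (hj : j ∉ S) :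
    S.map (Equiv.swap i j).toEmbedding = S := by
  rw [map_eq_image]
  refine (image_congr fun k hk => ?_).trans image_id
  have hki : k ≠ i := fun h => hi (h ▸ hk)
  have hkj : k ≠ j := fun h => hj (h ▸ hk)
  simp [Equiv.swap_apply_of_ne_of_ne hki hkj]

lemma map_swap_insert {i j : Fin n} {S : Finset (Fin n)} (hi : i ∉ S) (hj : j ∉ S) :
    (insert i S).map (Equiv.swap i j).toEmbedding = insert j S := by
  rw [map_insert, map_swap_of_notMem hi hj]
  simp

lemma faithBanzhaf_symmetry (n : ℕ) : Symmetry n faithBanzhaf := by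
  intro ℓ _ _ v i j hv T hi hj _
  have hsub : ∀ U, v (U.map (Equiv.swap i j).toEmbedding) = v U := by
    intro U
    by_cases hiU : i ∈ U <;> by_cases hjU : j ∈ U
    · congr 1
      ext k
      rw [mem_map_equiv, Equiv.symm_swap]
      rcases eq_or_ne k i with rfl | hki
      · simp [hiU, hjU]
      · rcases eq_or_ne k j with rfl | hkj
        · simp [hiU, hjU]
        · rw [Equiv.swap_apply_of_ne_of_ne hki hkj]
    · have hj' : j ∉ U.erase i := fun h => hjU (mem_of_mem_erase h)
      rw [← insert_erase hiU, map_swap_insert (notMem_erase i U) hj',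
        hv _ (notMem_erase i U) hj']
    · have hi' : i ∉ U.erase j := fun h => hiU (mem_of_mem_erase h)
      rw [← insert_erase hjU, Equiv.swap_comm, map_swap_insert (notMem_erase j U) hi',
        hv _ hi' (notMem_erase j U)]
    · rw [map_swap_of_notMem hiU hjU]
  rw [← faithBanzhaf_map (Equiv.swap i j) hsub, map_swap_insert hi hj]

/-! ### Optimality of the closed form for constant weights. -/

lemma sum_neg_one_pow_mul_choose_mul_choose {N L : ℕ} (h : L < N) :
    ∑ k ∈ range (L + 1),
      (N.choose k : ℝ) * ((-1) ^ (L - k) * ((N - k - 1).choose (L - k) : ℝ)) = 1 := by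
  induction L with
  | zero => simp
  | succ L ih =>
    -- Pascal's rule: passing from `L` to `L + 1` changes the `k`-th term by a multiple, independent
    -- of `k`, of `(-1) ^ k * (L + 1).choose k`, and these sum to zero.
    have hs : ∀ k ∈ range (L + 1 + 1),
        (N.choose k : ℝ) * ((-1) ^ (L + 1 - k) * ((N - k - 1).choose (L + 1 - k) : ℝ)) =
        (-1) ^ (L + 1) * (N.choose (L + 1) : ℝ) * ((-1) ^ k * ((L + 1).choose k : ℝ)) +
        if k < L + 1 then
          (N.choose k : ℝ) * ((-1) ^ (L - k) * ((N - k - 1).choose (L - k) : ℝ)) else 0 := by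
      intro k hk
      have hk' : k ≤ L + 1 := Nat.lt_succ_iff.1 (mem_range.1 hk)
      have h1 : (N.choose (L + 1) : ℝ) * ((L + 1).choose k : ℝ) =
          (N.choose k : ℝ) * ((N - k).choose (L + 1 - k) : ℝ) := by
        exact_mod_cast Nat.choose_mul hk'
      have h2 : (-1 : ℝ) ^ (L + 1) * (-1) ^ k = (-1) ^ (L + 1 - k) := by
        rw [← pow_add, show L + 1 + k = (L + 1 - k) + 2 * k by omega, pow_add, pow_mul]
        simp
      have h3 : (-1) ^ (L + 1) * (N.choose (L + 1) : ℝ) * ((-1) ^ k * ((L + 1).choose k : ℝ)) =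
          (-1) ^ (L + 1 - k) * ((N.choose k : ℝ) * ((N - k).choose (L + 1 - k) : ℝ)) := by
        rw [← h1, ← h2]; ring
      rw [h3]
      split_ifs with hlt
      · obtain ⟨m, rfl⟩ : ∃ m, L = k + m := ⟨L - k, by omega⟩
        obtain ⟨q, rfl⟩ : ∃ q, N = k + q + 1 := ⟨N - k - 1, by omega⟩
        rw [show k + m + 1 - k = m + 1 by omega, show k + m - k = m by omega,
          show k + q + 1 - k - 1 = q by omega, show k + q + 1 - k = q + 1 by omega,
          Nat.choose_succ_succ]
        push_cast
        ring
      · obtain rfl : k = L + 1 := by omega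
        simp
    rw [sum_congr rfl hs, sum_add_distrib, ← mul_sum, sum_range_neg_one_pow_choose,
      if_neg (Nat.succ_ne_zero L), mul_zero, zero_add, sum_range_succ, if_neg (lt_irrefl _),
      add_zero]
    exact (sum_congr rfl fun k hk => if_pos (mem_range.1 hk)).trans (ih (by omega))

/-- The total share of `moebius v R`, for `R` of order above `ℓ`, that the correction terms pass on
to the Walsh coefficient at `T`. -/
lemma sum_Icc_neg_one_pow_mul_choose {ℓ : ℕ} {T R : Finset (Fin n)} (hTR : T ⊆ R)
    (hT : #T ≤ ℓ) (hR : ℓ < #R) :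
    ∑ S ∈ Icc T R, (if #S ≤ ℓ then
      (-1 : ℝ) ^ (ℓ - #S) * ((#R - #S - 1).choose (ℓ - #S) : ℝ) else 0) = 1 := by
  rw [sum_Icc_card hTR
    (fun s => if s ≤ ℓ then (-1 : ℝ) ^ (ℓ - s) * ((#R - s - 1).choose (ℓ - s) : ℝ) else 0)]
  refine Eq.trans ?_
    (sum_neg_one_pow_mul_choose_mul_choose (show ℓ - #T < #R - #T by omega))
  have hsub : range (ℓ - #T + 1) ⊆ range (#R - #T + 1) := range_subset_range.2 (by omega)
  rw [← sum_subset hsub]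
  · refine sum_congr rfl fun k hk => ?_
    have := mem_range.1 hk
    rw [if_pos (by omega), Nat.sub_add_eq, Nat.sub_add_eq]
  · intro k _ hk
    rw [mem_range] at hk
    rw [if_neg (by omega), mul_zero]

/-- The Faith-Banzhaf approximation has the same Walsh coefficients as `v` up to order `ℓ`. -/
lemma sum_walsh_mul_approx_faithBanzhaf (ℓ : ℕ) (v : SetFunction n) {T : Finset (Fin n)}
    (hT : #T ≤ ℓ) :
    ∑ U, walsh T U * approx ℓ (faithBanzhaf n ℓ v) U = ∑ U, walsh T U * v U := by
  rw [sum_walsh_mul_approx, sum_walsh_mul]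
  congr 1
  have hsplit : ∑ S with T ⊆ S, (2 : ℝ) ^ (n - #S) * moebius v S =
      ∑ S with T ⊆ S ∧ #S ≤ ℓ, 2 ^ (n - #S) * moebius v S +
      ∑ R with T ⊆ R ∧ ℓ < #R, 2 ^ (n - #R) * moebius v R := by
    rw [← sum_filter_add_sum_filter_not _ (fun S => #S ≤ ℓ), filter_filter, filter_filter]
    simp only [not_le]
  simp only [faithBanzhaf, mul_add, sum_add_distrib]
  rw [hsplit]
  congr 1
  simp only [mul_sum]
  rw [sum_comm' (s' := fun R => {S ∈ Icc T R | #S ≤ ℓ})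
    (t' := ({R | T ⊆ R ∧ ℓ < #R} : Finset (Finset (Fin n))))]
  · refine sum_congr rfl fun R hR => ?_
    obtain ⟨hTR, hR⟩ := (mem_filter.1 hR).2
    have hone := congrArg (2 ^ (n - #R) * moebius v R * ·)
      (sum_Icc_neg_one_pow_mul_choose hTR hT hR)
    simp only [mul_one, mul_sum] at hone
    rw [← hone, sum_filter]
    refine sum_congr rfl fun S hS => ?_
    have h1 := card_le_card (mem_Icc.1 hS).2
    have h2 : #R ≤ n := by simpa using card_le_univ R
    split_ifs with hSℓ
    -- The powers of two combine to a factor independent of `S`, leaving the purely binomial sum.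
    · have h3 : (2 : ℝ) ^ (n - #S) * (1 / 2) ^ (#R - #S) = 2 ^ (n - #R) := by
        rw [show n - #S = (n - #R) + (#R - #S) by omega, pow_add, mul_assoc, ← mul_pow]
        norm_num
      rw [← h3]
      ring
    · simp
  · intro S R
    simp only [mem_filter, mem_univ, true_and, mem_Icc]
    exact ⟨fun h => ⟨⟨⟨h.1.1, h.2.1⟩, h.1.2⟩, h.1.1.trans h.2.1, h.2.2⟩,
      fun h => ⟨⟨h.1.1.1, h.1.2⟩, h.1.1.2, h.2.2⟩⟩

lemma isOrthogonal_faithBanzhaf {μ : Finset (Fin n) → ℝ≥0∞} {c : ℝ≥0∞}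
    (hμ : ∀ S, μ S = c) (ℓ : ℕ) (v : SetFunction n) :
    IsOrthogonal μ ℓ v (faithBanzhaf n ℓ v) := by
  intro f _
  simp only [hμ]
  rw [← mul_sum, sum_mul_approx, sum_eq_zero, mul_zero]
  intro S hS
  have hS' := (mem_filter.1 hS).2
  rw [sum_filter]
  have h1 : ∀ U, (if S ⊆ U then v U - approx ℓ (faithBanzhaf n ℓ v) U else 0) =
      (1 / 2) ^ #S * ∑ T ∈ S.powerset,
        (-1) ^ #T * (walsh T U * (v U - approx ℓ (faithBanzhaf n ℓ v) U)) := by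
    intro U
    rw [← one_mul (v U - _), ← zero_mul (v U - _), ← ite_mul, indicator_subset_eq, mul_assoc,
      sum_mul]
    simp only [one_mul, mul_assoc]
  rw [sum_congr rfl fun U _ => h1 U, ← mul_sum, sum_comm, sum_eq_zero, mul_zero, mul_zero]
  intro T hT
  have hT' := card_le_card (mem_powerset.1 hT)
  simp only [← mul_sum, mul_sub, sum_sub_distrib]
  rw [sum_walsh_mul_approx_faithBanzhaf ℓ v (hT'.trans hS')]
  simp

lemma isWeightingOf_faithBanzhaf {μ : Finset (Fin n) → ℝ≥0∞} {c : ℝ} (hc : 0 < c)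
    (hμ : ∀ S, μ S = ENNReal.ofReal (c * (1 / 2 ^ n))) : IsWeightingOf μ faithBanzhaf := by
  have hfin : ∀ S, μ S ≠ ∞ := fun S => by rw [hμ S]; exact ENNReal.ofReal_ne_top
  refine ⟨⟨fun S => ?_, fun S _ _ => hfin S⟩, fun ℓ _ _ v => ?_⟩
  · rw [hμ S, ENNReal.ofReal_pos]
    positivity
  · exact (isOrthogonal_faithBanzhaf hμ ℓ v).isRegressionSolution fun S hS => (hfin S hS).elim

/-! ### The highest order -/

lemma banzhaf_eq_walsh (v : SetFunction n) (S : Finset (Fin n)) :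
    banzhaf v S = (-1) ^ #S / 2 ^ (n - #S) * ∑ U, walsh S U * v U := by
  have h1 : ∑ U, walsh S U * v U =
      ∑ T ∈ (univ \ S).powerset, ∑ L ∈ S.powerset, (-1) ^ #L * v (T ∪ L) := by
    rw [← sum_product']
    refine sum_nbij' (fun U => (U \ S, U ∩ S)) (fun p => p.1 ∪ p.2) ?_ ?_ ?_ ?_ ?_
    · intro U _
      simp only [mem_product, mem_powerset]
      exact ⟨sdiff_subset_sdiff (subset_univ U) le_rfl, inter_subset_right⟩
    · simp
    · intro U _
      exact sdiff_union_inter U S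
    · rintro ⟨T, L⟩ h
      simp only [mem_product, mem_powerset] at h
      have hT : Disjoint T S := sdiff_disjoint.mono_left h.1
      ext k
      · simp only [mem_sdiff, mem_union]
        have : k ∈ L → k ∈ S := fun hk => h.2 hk
        have : k ∈ T → k ∉ S := fun hk => disjoint_left.1 hT hk
        tauto
      · simp only [mem_inter, mem_union]
        have : k ∈ L → k ∈ S := fun hk => h.2 hk
        have : k ∈ T → k ∉ S := fun hk => disjoint_left.1 hT hk
        tauto
    · intro U _
      simp only [sdiff_union_inter]
      rw [walsh, inter_comm]
  rw [h1, banzhaf, mul_sum]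
  refine sum_congr rfl fun T _ => ?_
  rw [discreteDerivative, mul_sum, mul_sum]
  refine sum_congr rfl fun L hL => ?_
  have hc := card_le_card (mem_powerset.1 hL)
  have h2 : (-1 : ℝ) ^ (#S - #L) = (-1) ^ #S * (-1) ^ #L := by
    rw [← pow_add, show #S + #L = (#S - #L) + 2 * #L by omega, pow_add, pow_mul]
    simp
  rw [h2]
  ring

/-- For `ℓ = #S` the sign and the binomials are 1, so the closed form becomes the superset sum in
`sum_walsh_mul`, up to scaling. -/
lemma faithBanzhaf_card (v : SetFunction n) (S : Finset (Fin n)) :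
    faithBanzhaf n #S v S = banzhaf v S := by
  rw [banzhaf_eq_walsh, sum_walsh_mul, ← mul_assoc, div_mul_eq_mul_div, ← mul_pow, faithBanzhaf]
  have h1 : ∀ T ∈ ({T | S ⊆ T} : Finset (Finset (Fin n))),
      (1 / 2 : ℝ) ^ (#T - #S) * moebius v T =
        1 / 2 ^ (n - #S) * (2 ^ (n - #T) * moebius v T) := by
    intro T hT
    have h2 := card_le_card (mem_filter.1 hT).2
    have h3 : #T ≤ n := by simpa using card_le_univ T
    rw [show n - #S = (n - #T) + (#T - #S) by omega, pow_add, one_div_pow]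
    field_simp
  simp only [mul_neg, mul_one, neg_neg, one_pow]
  rw [mul_sum (a := (1 : ℝ) / 2 ^ (n - #S)), ← sum_congr rfl h1]
  have hmem : S ∈ ({T | S ⊆ T} : Finset (Finset (Fin n))) := by simp
  rw [← add_sum_erase _ _ hmem]
  simp only [Nat.sub_self, pow_zero, one_mul, Nat.choose_zero_right, Nat.cast_one, mul_one]
  congr 1
  refine sum_congr ?_ fun _ _ => rfl
  ext T
  simp only [mem_filter, mem_univ, true_and, mem_erase]
  constructor
  · rintro ⟨h2, h3⟩
    exact ⟨fun h => by simp [h] at h3, h2⟩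
  · rintro ⟨h2, h3⟩
    exact ⟨h3, card_lt_card (h3.ssubset_of_ne h2.symm)⟩

/-! ### Merging two players. -/

lemma walsh_reduced {i j : Fin n} {π : Fin n → Fin (n - 1)} (hπ : Set.InjOn π {k | k ≠ j})
    {S : Finset (Fin n)} (hj : j ∉ S) (hij : i ≠ j) (W : Finset (Fin (n - 1))) :
    walsh (insert (π i) (S.image π)) W = walsh (insert i S) {k | π k ∈ W} := by
  rw [← image_insert, walsh_eq_prod, walsh_eq_prod, prod_image]
  · simp
  · refine hπ.mono fun k hk => ?_
    rintro rfl
    rcases mem_insert.1 (mem_coe.1 hk) with h | h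
    exacts [hij h.symm, hj h]

/-- Without `j` the map is still onto, as `i` covers its image; domain and codomain then have equal
size. -/
lemma injOn_of_surjective_of_eq {i j : Fin n} {π : Fin n → Fin (n - 1)}
    (hπ : Function.Surjective π) (hij : i ≠ j) (h : π i = π j) : Set.InjOn π {k | k ≠ j} := by
  have himg : (univ.erase j).image π = univ := by
    refine eq_univ_of_forall fun y => ?_
    obtain ⟨k, rfl⟩ := hπ y
    rcases eq_or_ne k j with rfl | hk
    · exact mem_image.2 ⟨i, by simpa using hij, h⟩
    · exact mem_image_of_mem π (by simpa using hk)
  have hcard : #((univ.erase j).image π) = #(univ.erase j) := by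
    rw [himg, card_erase_of_mem (mem_univ j)]
    simp
  exact (card_image_iff.1 hcard).mono fun k hk => by simpa using hk

/-- Coalitions of the merged players correspond to those containing both or neither of `i` and `j`.
-/
lemma sum_reduced {i j : Fin n} {π : Fin n → Fin (n - 1)}
    (hπ : Function.Surjective π) (hij : i ≠ j) (h : π i = π j) (g : Finset (Fin n) → ℝ) :
    ∑ W : Finset (Fin (n - 1)), g {k | π k ∈ W} = ∑ U with (i ∈ U ↔ j ∈ U), g U := by
  have hinj := injOn_of_surjective_of_eq hπ hij h
  refine sum_nbij' (fun W => ({k | π k ∈ W} : Finset (Fin n))) (fun U => U.image π) ?_ ?_ ?_ ?_ ?_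
  · intro W _
    simp [h]
  · simp
  · intro W _
    ext y
    obtain ⟨k, rfl⟩ := hπ y
    simp only [mem_image, mem_filter, mem_univ, true_and]
    exact ⟨fun ⟨a, ha, hak⟩ => hak ▸ ha, fun hk => ⟨k, hk, rfl⟩⟩
  · intro U hU
    have hU' := (mem_filter.1 hU).2
    ext k
    simp only [mem_image, mem_filter, mem_univ, true_and]
    refine ⟨?_, fun hk => ⟨k, hk, rfl⟩⟩
    rintro ⟨a, ha, hak⟩
    have key : ∀ a b, a ≠ j → b ≠ j → π a = π b → a = b := fun a b ha hb hab => hinj ha hb hab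
    rcases eq_or_ne a j with rfl | haj
    · rcases eq_or_ne k a with rfl | hk
      · exact ha
      · rw [← key i k hij hk (h.trans hak)]
        exact hU'.2 ha
    · rcases eq_or_ne k j with rfl | hk
      · rw [key a i haj hij (hak.trans h.symm)] at ha
        exact hU'.1 ha
      · exact key a k haj hk hak ▸ ha
  · simp

lemma faithBanzhaf_twoEfficiency (n : ℕ) : TwoEfficiency n faithBanzhaf := by
  intro i j hij π hπ h v S hi hj
  have hinj := injOn_of_surjective_of_eq hπ hij h
  have hc : #(insert (π i) (S.image π)) = #S + 1 := by
    rw [← image_insert, card_image_of_injOn, card_insert_of_notMem hi]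
    refine hinj.mono fun k hk => ?_
    rintro rfl
    rcases mem_insert.1 (mem_coe.1 hk) with h | h
    exacts [hij h.symm, hj h]
  have hci := card_insert_of_notMem hi
  have hcj := card_insert_of_notMem hj
  have hn : #S + 2 ≤ n := by
    have h1 : #(insert j (insert i S)) ≤ n := by simpa using card_le_univ (insert j (insert i S))
    rwa [card_insert_of_notMem (by simp [hij.symm, hj]), hci] at h1
  have e0 := faithBanzhaf_card (reduced π v) (insert (π i) (S.image π))
  have e1 := faithBanzhaf_card v (insert i S)
  have e2 := faithBanzhaf_card v (insert j S)
  rw [banzhaf_eq_walsh] at e0 e1 e2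
  rw [hc] at e0
  rw [hci] at e1
  rw [hcj] at e2
  rw [e0, e1, e2, ← mul_add, ← sum_add_distrib]
  simp_rw [walsh_reduced hinj hj hij, reduced]
  rw [sum_reduced hπ hij h (fun U => walsh (insert i S) U * v U)]
  -- The factor 2 compensates for the normalization, which has one player fewer in the merged game.
  have h2 : ∀ U, walsh (insert i S) U * v U + walsh (insert j S) U * v U =
      if (i ∈ U ↔ j ∈ U) then 2 * (walsh (insert i S) U * v U) else 0 := by
    intro U
    rw [walsh_insert hi, walsh_insert hj, walsh_singleton, walsh_singleton]
    by_cases hiU : i ∈ U <;> by_cases hjU : j ∈ U <;> simp [hiU, hjU] <;> ring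
  rw [sum_congr rfl fun U _ => h2 U, ← sum_filter, ← mul_sum,
    show n - (#S + 1) = (n - 1 - (#S + 1)) + 1 by omega,
    pow_succ (2 : ℝ)]
  field_simp

lemma faithBanzhaf_isAdmissible (n : ℕ) : IsAdmissible n faithBanzhaf where
  faith := ⟨fun _ => ENNReal.ofReal (1 * (1 / 2 ^ n)),
    isWeightingOf_faithBanzhaf one_pos fun _ => rfl⟩
  linearity := faithBanzhaf_linearity n
  symmetry := faithBanzhaf_symmetry n
  dummy := faithBanzhaf_dummy n
  twoEfficiency := faithBanzhaf_twoEfficiency n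

/-! ### The weights -/

/-- For a proper weighting `μ`, the regression of order `1` of `walsh B / μ` vanishes as soon as
`B` has two elements. -/
lemma regression_walsh_div {μ : Finset (Fin n) → ℝ≥0∞} (hμ : ∀ S, 0 < μ S)
    {B : Finset (Fin n)} (hB : 1 < #B) {f : Finset (Fin n) → ℝ}
    (hf : IsRegressionSolution μ 1 (fun U => walsh B U * (μ U).toReal⁻¹) f)
    (S : Finset (Fin n)) (hS : #S ≤ 1) : f S = 0 := by
  refine hf.eq_of_isOrthogonal hμ (e := 0) (fun U hU => ?_) (fun g hg => ?_) S hS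
  -- As `∞.toReal⁻¹ = 0`, the game vanishes where an exact fit is required, so `0` is feasible.
  · simp [hU, approx]
  · have h1 : ∀ U, (μ U).toReal * ((walsh B U * (μ U).toReal⁻¹ - approx 1 0 U) * approx 1 g U) =
        walsh B U * approx 1 g U := by
      intro U
      by_cases hU : μ U = ∞
      · rw [hg U hU, mul_zero, mul_zero, mul_zero]
      · have h2 : (μ U).toReal ≠ 0 := (ENNReal.toReal_pos (hμ U).ne' hU).ne'
        rw [show approx 1 (0 : Finset (Fin n) → ℝ) U = 0 by simp [approx]]
        field_simp
        ring
    -- After the weight cancels, no coalition of size at most 1 contains `B`.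
    rw [sum_congr rfl fun U _ => h1 U, sum_walsh_mul_approx, filter_false_of_mem, sum_empty,
      mul_zero]
    intro T _ hT
    have := card_le_card hT.1
    omega

/-- A weighting whose regressions of order `1` yield the Banzhaf values is constant. -/
lemma weighting_const (hn : 3 ≤ n) {μ : Finset (Fin n) → ℝ≥0∞} (hμ : IsProperWeighting μ)
    (hsol : ∀ v : SetFunction n, ∃ f, IsRegressionSolution μ 1 v f ∧
      ∀ i, f {i} = banzhaf v {i}) :
    ∃ c : ℝ, 0 < c ∧ ∀ S, μ S = ENNReal.ofReal (c * (1 / 2 ^ n)) := by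
  have key : ∀ (B : Finset (Fin n)) (i : Fin n), 1 < #B →
      ∑ U, walsh {i} U * (walsh B U * (μ U).toReal⁻¹) = 0 := by
    intro B i hB
    obtain ⟨f, hf, hb⟩ := hsol fun U => walsh B U * (μ U).toReal⁻¹
    have h1 := hb i
    rw [regression_walsh_div hμ.1 hB hf {i} (by simp), banzhaf_eq_walsh] at h1
    refine (mul_eq_zero.1 h1.symm).resolve_left ?_
    simp
  have hconst := eq_average_of_walsh_eq_zero (fun U => (μ U).toReal⁻¹) (n := n) <| by
    intro T hT
    by_cases hTu : T = univ
    -- No player lies outside `T = univ`, so one is removed instead; `n ≥ 3` keeps two players in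
    -- `B`.
    · let i : Fin n := ⟨0, by omega⟩
      have h1 := key (univ.erase i) i (by
        rw [card_erase_of_mem (mem_univ i), card_univ, Fintype.card_fin]; omega)
      simp_rw [← mul_assoc, ← walsh_insert (notMem_erase i univ),
        insert_erase (mem_univ i)] at h1
      rwa [hTu]
    · obtain ⟨i, hi⟩ : ∃ i, i ∉ T := by
        by_contra! h
        exact hTu (eq_univ_of_forall h)
      have h1 := key (insert i T) i (by
        rw [card_insert_of_notMem hi]
        have := hT.card_pos
        omega)
      simp_rw [walsh_insert hi, ← mul_assoc, walsh_mul_self, one_mul] at h1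
      exact h1
  set s := ∑ U, (μ U).toReal⁻¹
  have hs : 0 < s := by
    have h1 : μ {⟨0, by omega⟩} ≠ ∞ := hμ.2 _ (by simp) (by simp; omega)
    rw [← hconst {⟨0, by omega⟩}]
    have := ENNReal.toReal_pos (hμ.1 _).ne' h1
    positivity
  -- Every inverse weight equals the average `s / 2 ^ n`, so `μ` is `2 ^ n / s`. An infinite weight
  -- would have inverse `0`, against `0 < s`.
  refine ⟨2 ^ n * (2 ^ n / s), by positivity, fun S => ?_⟩
  have h1 := hconst S
  have hpos : 0 < (μ S).toReal := by
    rcases ENNReal.toReal_nonneg.eq_or_lt (a := (0 : ℝ)) (b := (μ S).toReal) with h | h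
    · rw [← h] at h1
      simp at h1
      exact absurd h1 hs.ne
    · exact h
  have hfin : μ S ≠ ∞ := fun h => by simp [h] at hpos
  rw [← ENNReal.ofReal_toReal hfin]
  congr 1
  rw [← h1]
  field_simp

/-! ### Uniqueness -/

lemma IsAdmissible.eq_of_order_one {E : InteractionIndex} {d : ℕ}
    (hE : ∀ n, 1 ≤ n → n ≤ d → IsAdmissible n E) (hn : 1 ≤ n) (hnd : n ≤ d)
    (v : SetFunction n) (i : Fin n) : E n 1 v {i} = faithBanzhaf n 1 v {i} := by
  induction n, hn using Nat.le_induction with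
  | base =>
    obtain ⟨μ, hμ, hsol⟩ := (hE 1 le_rfl hnd).faith
    -- With one player, order 1 already fits `v` exactly.
    have h0 : ∀ S, approx 1 (faithBanzhaf 1 1 v) S = v S := by
      have h1 : faithBanzhaf 1 1 v = moebius v := by
        funext S
        rw [faithBanzhaf, filter_false_of_mem]
        · simp
        · intro T _ hT
          have : #T ≤ 1 := by simpa using card_le_univ T
          omega
      rw [h1]
      exact approx_moebius v
    refine (hsol 1 le_rfl le_rfl v).eq_of_isOrthogonal hμ.1 (fun S _ => (h0 S).symm)
      (fun f _ => ?_) {i} (by simp)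
    simp [h0]
  | succ n hn ih =>
    have hA := hE (n + 1) (by omega) hnd
    have hB := faithBanzhaf_isAdmissible (n + 1)
    have ih' := ih (by omega)
    have hD : ∀ (w : SetFunction (n + 1)) (i j : Fin (n + 1)), i ≠ j →
        (E (n + 1) 1 w {i} - faithBanzhaf (n + 1) 1 w {i}) +
          (E (n + 1) 1 w {j} - faithBanzhaf (n + 1) 1 w {j}) = 0 := by
      intro w i j hij
      obtain ⟨π, hπ, hπij⟩ : ∃ π : Fin (n + 1) → Fin n, Function.Surjective π ∧ π i = π j := by
        obtain ⟨i', rfl⟩ := Fin.exists_succAbove_eq hij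
        -- Delete `j` from the list of players and give it the name `i'` of `i`.
        refine ⟨fun k => if h : k = j then i' else (finSuccAboveEquiv j).symm ⟨k, h⟩, ?_, ?_⟩
        · intro y
          refine ⟨j.succAbove y, ?_⟩
          dsimp only
          rw [dif_neg (Fin.succAbove_ne j y), Equiv.symm_apply_eq]
          rfl
        · dsimp only
          rw [dif_neg hij, dif_pos rfl, Equiv.symm_apply_eq]
          rfl
      have h1 := hA.twoEfficiency i j hij π hπ hπij w ∅ (by simp) (by simp)
      have h2 := hB.twoEfficiency i j hij π hπ hπij w ∅ (by simp) (by simp)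
      simp only [card_empty, zero_add, image_empty, insert_empty_eq] at h1 h2
      have h3 : E (n + 1 - 1) 1 (reduced π w) {π i} =
          faithBanzhaf (n + 1 - 1) 1 (reduced π w) {π i} := ih' (reduced π w) (π i)
      linarith
    rcases hn.eq_or_lt with rfl | hn2
    · obtain ⟨j, hj⟩ : ∃ j : Fin 2, j ≠ i := exists_ne i
      have hempty : ∀ S : Finset (Fin 2), i ∉ S → j ∉ S → S = ∅ := by
        intro S hiS hjS
        refine eq_empty_of_forall_notMem fun k hk => ?_
        have h1 : k ≠ i := fun h => hiS (h ▸ hk)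
        have h2 : k ≠ j := fun h => hjS (h ▸ hk)
        omega
      -- With two players one pair equation is not enough. Subtracting `u`, in which `j` is a dummy,
      -- makes `i` and `j` symmetric in `v - u`: symmetry settles `v - u`, the dummy axiom settles
      -- `u`, and linearity adds them.
      let u : SetFunction 2 := fun S => if i ∈ S then v {i} - v {j} else 0
      have hu : ∀ S, j ∉ S → u (insert j S) = u S := fun S _ => by simp [u, hj.symm]
      have hs : ∀ S, i ∉ S → j ∉ S → (v - u) (insert i S) = (v - u) (insert j S) := by
        intro S hiS hjS
        rw [hempty S hiS hjS]
        simp [u, hj.symm]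
      have s1 := hA.symmetry 1 le_rfl (by omega) (v - u) i j hs ∅ (by simp) (by simp) (by simp)
      have s2 := hB.symmetry 1 le_rfl (by omega) (v - u) i j hs ∅ (by simp) (by simp) (by simp)
      have d1 := hA.dummy 1 le_rfl (by omega) u j hu {j} (by simp) (by simp)
      have d2 := hB.dummy 1 le_rfl (by omega) u j hu {j} (by simp) (by simp)
      have l1 := hA.linearity 1 le_rfl (by omega) (v - u) u 1 1 {i} (by simp)
      have l2 := hB.linearity 1 le_rfl (by omega) (v - u) u 1 1 {i} (by simp)
      simp only [one_smul, sub_add_cancel, one_mul, insert_empty_eq] at s1 s2 l1 l2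
      have h1 := hD (v - u) i j hj.symm
      have h2 := hD u i j hj.symm
      simp only [Nat.reduceAdd] at *
      linarith
    -- Three numbers whose pairwise sums vanish are all zero.
    · obtain ⟨j, k, hij, hik, hjk⟩ : ∃ j k : Fin (n + 1), i ≠ j ∧ i ≠ k ∧ j ≠ k := by
        have h1 : 1 < #(univ.erase i) := by
          rw [card_erase_of_mem (mem_univ i), card_univ, Fintype.card_fin]; omega
        obtain ⟨j, hj, k, hk, hjk⟩ := one_lt_card.1 h1
        exact ⟨j, k, (ne_of_mem_erase hj).symm, (ne_of_mem_erase hk).symm, hjk⟩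
      have h1 := hD v i j hij
      have h2 := hD v i k hik
      have h3 := hD v j k hjk
      linarith

end FaithInteraction

theorem mainTheorem3 :
    ∃ E : InteractionIndex,
      (∀ n, 1 ≤ n → IsAdmissible n E) ∧
      ∀ d : ℕ, 3 ≤ d →
        (∀ E' : InteractionIndex, (∀ n, 1 ≤ n → n ≤ d → IsAdmissible n E') →
          ∀ ℓ, 1 ≤ ℓ → ℓ ≤ d → ∀ (v : SetFunction d) (S : Finset (Fin d)), #S ≤ ℓ →
            E' d ℓ v S = E d ℓ v S) ∧
        (∀ μ : Finset (Fin d) → ℝ≥0∞,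
          IsWeightingOf μ E ↔
            ∃ c : ℝ, 0 < c ∧ ∀ S, μ S = ENNReal.ofReal (c * (1 / 2 ^ d))) ∧
        (∀ ℓ, 1 ≤ ℓ → ℓ ≤ d → ∀ (v : SetFunction d) (S : Finset (Fin d)), #S ≤ ℓ →
          E d ℓ v S = moebius v S + (-1) ^ (ℓ - #S) *
            ∑ T with S ⊆ T ∧ ℓ < #T,
              (1 / 2) ^ (#T - #S) * ((#T - #S - 1).choose (ℓ - #S) : ℝ) * moebius v T) ∧
        (∀ ℓ, 1 ≤ ℓ → ℓ ≤ d → ∀ (v : SetFunction d) (S : Finset (Fin d)), #S = ℓ →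
          E d ℓ v S = banzhaf v S) := by
  refine ⟨faithBanzhaf, fun n _ => faithBanzhaf_isAdmissible n, fun d hd =>
    ⟨fun E hE ℓ hℓ hℓd v S hS => ?_, fun μ => ⟨fun hμ => ?_, ?_⟩, fun _ _ _ _ _ _ => rfl, ?_⟩⟩
  · obtain ⟨μ, hμ, hsol⟩ := (hE d (by omega) le_rfl).faith
    -- One `μ` serves all orders, so order 1 fixes it and uniqueness of the regression settles order
    -- `ℓ`.
    obtain ⟨c, -, hconst⟩ := weighting_const hd hμ fun w =>
      ⟨E d 1 w, hsol 1 le_rfl (by omega) w, fun i => by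
        rw [IsAdmissible.eq_of_order_one hE (by omega) le_rfl w i]
        exact faithBanzhaf_card w {i}⟩
    refine (hsol ℓ hℓ hℓd v).eq_of_isOrthogonal hμ.1 (fun U hU => ?_)
      (isOrthogonal_faithBanzhaf hconst ℓ v) S hS
    rw [hconst U] at hU
    exact (ENNReal.ofReal_ne_top hU).elim
  · exact weighting_const hd hμ.1 fun w =>
      ⟨_, hμ.2 1 le_rfl (by omega) w, fun i => faithBanzhaf_card w {i}⟩
  · rintro ⟨c, hc, hconst⟩
    exact isWeightingOf_faithBanzhaf hc hconst
  · rintro ℓ _ _ v S rfl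
    exact faithBanzhaf_card v S
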